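/- A string C-group of rank $r$ is a group $G$ with an ordered generating set of involutions $\rho_0,\dots,\rho_{r-1}$ such that $(\rho_j\rho_k)^2=1$ whenever $|j-k|\ge 2$, and $\langle \rho_k\mid k\in I\rangle\cap\langle\rho_k\mid k\in J\rangle=\langle\rho_k\mid k\in I\cap J\rangle$ for all $I,J\subseteq\{0,\dots,r-1\}$. The permutation representation graph of a permutation group $G$ generated by involutions $\rho_0,\dots,\rho_{r-1}$ is the edge-labelled undirected multigraph on the permuted points with an edge of label $k$ between $a$ and $b$ whenever $a\ne b$ and $\rho_k(a)=b$; this graph is said to represent $G$, and it is called a CPR graph if $(G,(\rho_0,\dots,\rho_{r-1}))$ is a string C-group. The rank-$r$ simplex is the path with vertices $v_0,\dots,v_r$ in which $v_k$ and $v_{k+1}$ are joined by an edge of label $k$ for $0\le k\le r-1$. Let $i\ge 2$ and $r\ge i+1$ be integers. Let $\mathcal G_{i,r}$ be the edge-labelled graph obtained from the rank-$r$ simplex on $v_0,\dots,v_r$ by adding $i$ new vertices $w_0,\dots,w_{i-1}$, an edge of label $p$ between $w_p$ and $w_{p+1}$ for $0\le p\le i-2$, and an edge of label $i$ between $v_p$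 and $w_p$ for $0\le p\le i-1$. (So $\mathcal G_{i,r}$ has $r+i+1$ vertices, and its labels are $0,\dots,r-1$.) Then $\mathcal G_{i,r}$ is a CPR graph. The group it represents is isomorphic to the symmetric group $S_{r+i+1}$ if $r>i+1$, and to the wreath product $S_r\wr C_2$ if $r=i+1$. -/

import Mathlib

/-- An undirected multigraph on `V` whose edges carry labels `0, …, r - 1`,
without loops and with at most one edge of each label between two given vertices:
for every label `k`, the simple graph formed by the edges of label `k`. -/
abbrev LabelledGraph (r : ℕ) (V : Type*) := Fin r → SimpleGraph V

/-- `(G, (ρ 0, …, ρ (r - 1)))` is a string C-group (the group `G` is given as a subgroup of some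
group `H`, so an abstract group is the case `G = ⊤`). -/
structure IsStringCGroup {H : Type*} [Group H] {r : ℕ} (G : Subgroup H) (ρ : Fin r → H) :
    Prop where
  /-- the `ρ k` are involutions -/
  involution : ∀ k, orderOf (ρ k) = 2
  /-- the `ρ k` generate `G` -/
  generates : Subgroup.closure (Set.range ρ) = G
  /-- the string property -/
  string : ∀ j k : Fin r, ((j : ℕ) + 2 ≤ k ∨ (k : ℕ) + 2 ≤ j) →
    (ρ j * ρ k) ^ 2 = 1
  /-- the intersection property -/
  intersection : ∀ I J : Set (Fin r),
    Subgroup.closure (ρ '' I) ⊓ Subgroup.closure (ρ '' J) = Subgroup.closure (ρ '' (I ∩ J))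

/-- `𝒢` is the permutation representation graph of the permutation group `G` on `V`, generated by
the involutions `ρ 0, …, ρ (r - 1)`: there is an edge of label `k` between `a` and `b` exactly when
`a ≠ b` and `ρ k a = b`. Note that `𝒢` determines `ρ` and `G`. -/
structure IsPermRepGraph {r : ℕ} {V : Type*} (𝒢 : LabelledGraph r V)
    (G : Subgroup (Equiv.Perm V)) (ρ : Fin r → Equiv.Perm V) : Prop where
  involution : ∀ k, orderOf (ρ k) = 2
  generates : Subgroup.closure (Set.range ρ) = G
  adj_iff : ∀ k a b, (𝒢 k).Adj a b ↔ a ≠ b ∧ ρ k a = b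

/-- `𝒢` is a CPR graph: it is the permutation representation graph of a permutation group which,
with its ordered generating set, is a string C-group. -/
def IsCPRGraph {r : ℕ} {V : Type*} (𝒢 : LabelledGraph r V) : Prop :=
  ∃ (G : Subgroup (Equiv.Perm V)) (ρ : Fin r → Equiv.Perm V),
    IsPermRepGraph 𝒢 G ρ ∧ IsStringCGroup G ρ

/-- `𝒢` is a permutation representation graph and the group it represents is isomorphic
to `Γ`. -/
def Represents {r : ℕ} {V : Type*} (𝒢 : LabelledGraph r V) (Γ : Type*) [Group Γ] : Prop :=
  ∃ (G : Subgroup (Equiv.Perm V)) (ρ : Fin r → Equiv.Perm V),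
    IsPermRepGraph 𝒢 G ρ ∧ Nonempty (G ≃* Γ)

/-- The rank-`r` simplex: the path on `r + 1` vertices `0, …, r` whose edges are labelled
`0, …, r - 1` in this order; the edge of label `k` joins the vertices `k` and `k + 1`. -/
def simplex (r : ℕ) : LabelledGraph r (Fin (r + 1)) :=
  fun k => SimpleGraph.edge k.castSucc k.succ

/-- Gluing a ladder to a labelled graph `𝒢` along the vertices `v 0, …, v (i - 1)`: add `i` new
vertices `0, …, i - 1`, make them a rank-`(i - 1)` simplex (an edge of label `p` joins the new
vertices `p` and `p + 1`, for `p + 1 < i`), and join `v p` to the new vertex `p` by an edge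
of label `i`, for every `p < i`. The old vertices are `Sum.inl a`, the new ones `Sum.inr p`. -/
def glueLadder {r : ℕ} {V : Type*} (𝒢 : LabelledGraph r V) (i : ℕ) (v : Fin i → V) :
    LabelledGraph r (V ⊕ Fin i) :=
  fun k =>
    { Adj := fun x y =>
        match x, y with
        | .inl a, .inl b => (𝒢 k).Adj a b
        | .inr p, .inr q =>
            ((p : ℕ) = k ∧ (q : ℕ) = k + 1) ∨ ((q : ℕ) = k ∧ (p : ℕ) = k + 1)
        | .inl a, .inr p => (k : ℕ) = i ∧ a = v p
        | .inr p, .inl a => (k : ℕ) = i ∧ a = v p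
      symm := ⟨by
        rintro (a | p) (b | q) h
        · exact (𝒢 k).adj_symm h
        · exact h
        · exact h
        · exact Or.symm h⟩
      loopless := ⟨by
        rintro (a | p) h
        · exact (𝒢 k).loopless.irrefl a h
        · rcases h with ⟨h₁, h₂⟩ | ⟨h₁, h₂⟩ <;> omega⟩ }

/-- The ladder glued to the rank-`r` simplex along its first `i` vertices `0, …, i - 1`. -/
def simplexLadder (i r : ℕ) (h : i ≤ r + 1) : LabelledGraph r (Fin (r + 1) ⊕ Fin i) :=
  glueLadder (simplex r) i (Fin.castLE h)

/-! For every set I of labels, the subgroup generated by the `rho j` with j ∈ I equals the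
intersection of the `maxParabolic i r k` over k ∉ I: it is cut out by conditions attached to one
omitted label at a time. The intersection property then reduces to the complement of I ∩ J being the
union of the complements. Taking all labels identifies the group: the conditions for k ≥ r are
vacuous unless k = i + 1 = r, when preserving two blocks of size r is all that remains.

The conditions are these. Omitting k separates the positions ≤ k from the others. If k < i, the part
of the ladder left of the cut keeps its rows and columns as partitions; if k = i, each row is
preserved; if k = i + 1, the blocks {v_0, …, v_i} and {w_0, …, w_{i-1}, v_{i+1}} are preserved or
exchanged.

The hard inclusion is `mem_of_forall_mem_maxParabolic`. Let a, …, i - 1 be the longest run of labels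
of I ending at i - 1. Left of a both rows move together, up to the exchange made by label i, so a
given g is corrected there by at most one `rho i` and one element of the image of `diag`. From a
onwards, conjugating the generators that are transpositions produces every transposition the
invariants allow (`swap_mem_of_invariants`), and `mem_of_forall_swap_mem` finishes. -/

namespace SimplexLadder

open Equiv

/-! ### Subgroups containing transpositions -/

/-- A subgroup of a finite symmetric group contains every permutation all of whose moves
`x ↦ g x` are realised by transpositions in the subgroup. -/
theorem mem_of_forall_swap_mem {α : Type*} [DecidableEq α] [Finite α] (K : Subgroup (Perm α))
    {g : Perm α} (h : ∀ x, swap x (g x) ∈ K) : g ∈ K := by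
  have hle : Subgroup.closure {f : Perm α | f.IsSwap ∧ f ∈ K} ≤ K :=
    (Subgroup.closure_le K).2 fun f hf => hf.2
  -- A group generated by transpositions is the full product of the symmetric groups on its orbits.
  refine hle ((mem_closure_isSwap fun f hf => hf.1).2 ⟨Set.toFinite _, fun x => ?_⟩)
  by_cases hx : x = g x
  · rw [← hx]
    exact MulAction.mem_orbit_self x
  · exact ⟨⟨swap x (g x), Subgroup.subset_closure ⟨⟨x, g x, hx, rfl⟩, h x⟩⟩,
      swap_apply_left x (g x)⟩

theorem swap_apply_mem {α : Type*} [DecidableEq α] {K : Subgroup (Perm α)} {g : Perm α}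
    (hg : g ∈ K) {x y : α} (h : swap x y ∈ K) : swap (g x) (g y) ∈ K := by
  rw [Equiv.swap_apply_apply]
  exact K.mul_mem (K.mul_mem hg h) (K.inv_mem hg)

/-- Transpositions of consecutive terms of a sequence generate those of any two terms. -/
theorem swap_mem_of_consecutive {α : Type*} [DecidableEq α] {K : Subgroup (Perm α)} (f : ℕ → α)
    {p q : ℕ} (hpq : p ≤ q) (h : ∀ k, p ≤ k → k < q → swap (f k) (f (k + 1)) ∈ K) :
    swap (f p) (f q) ∈ K := by
  induction q, hpq using Nat.le_induction with
  | base =>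
    rw [swap_self]
    exact K.one_mem
  | succ q hq ih =>
    exact SubmonoidClass.swap_mem_trans K (ih fun k hk hk' => h k hk (by omega)) (h q hq (by omega))

/-- The permutations preserving a binary relation. -/
def relAut {α : Type*} (R : α → α → Prop) : Subgroup (Perm α) where
  carrier := {g | ∀ x y, R (g x) (g y) ↔ R x y}
  one_mem' _ _ := Iff.rfl
  mul_mem' {g h} hg hh x y := (hg (h x) (h y)).trans (hh x y)
  inv_mem' {g} hg x y := by simpa using (hg (g⁻¹ x) (g⁻¹ y)).symm

/-! ### Coordinates and generators -/

/-- The vertices of the simplex of rank `r` with a ladder of length `i`. -/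
abbrev Vertex (i r : ℕ) := Fin (r + 1) ⊕ Fin i

variable {i r : ℕ}

/-- The position of a vertex in its row. -/
def pos : Vertex i r → ℕ := Sum.elim Fin.val Fin.val

/-- The row of a vertex: `0` for the simplex, `1` for the new vertices. -/
def row : Vertex i r → ℕ := Sum.elim (fun _ => 0) (fun _ => 1)

@[simp] theorem pos_inl (a : Fin (r + 1)) : pos (.inl a : Vertex i r) = a := rfl
@[simp] theorem pos_inr (a : Fin i) : pos (.inr a : Vertex i r) = a := rfl
@[simp] theorem row_inl (a : Fin (r + 1)) : row (.inl a : Vertex i r) = 0 := rfl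
@[simp] theorem row_inr (a : Fin i) : row (.inr a : Vertex i r) = 1 := rfl

theorem vertex_ext {x y : Vertex i r} (hp : pos x = pos y) (hr : row x = row y) : x = y := by
  rcases x with a | a <;> rcases y with b | b <;> simp_all [Fin.ext_iff]

theorem row_pos_bounds (x : Vertex i r) :
    (row x = 0 ∧ pos x ≤ r) ∨ (row x = 1 ∧ pos x < i) := by
  rcases x with a | a
  · exact Or.inl ⟨rfl, Nat.lt_succ_iff.1 a.2⟩
  · exact Or.inr ⟨rfl, a.2⟩

/-- The vertex with given position and row. -/
def mk (p e : ℕ) : Vertex i r :=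
  -- Out-of-range pairs get junk values: they fall into row 0, with the position reduced modulo r +
  -- 1.
  if h : e = 1 ∧ p < i then .inr ⟨p, h.2⟩ else .inl (Fin.ofNat (r + 1) p)

theorem pos_row_mk {p e : ℕ} (h : (e = 0 ∧ p ≤ r) ∨ (e = 1 ∧ p < i)) :
    pos (mk p e : Vertex i r) = p ∧ row (mk p e : Vertex i r) = e := by
  rcases h with ⟨rfl, h⟩ | ⟨rfl, h⟩
  · simp [mk, Nat.mod_eq_of_lt (Nat.lt_succ_of_le h)]
  · simp [mk, h]

theorem mk_pos_row (x : Vertex i r) : mk (pos x) (row x) = x :=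
  vertex_ext (pos_row_mk (row_pos_bounds x)).1 (pos_row_mk (row_pos_bounds x)).2

/-- The effect of the generator `j` on the row of a vertex with position `p` and row `e`. -/
def stepRow (i j p e : ℕ) : ℕ := if j = i ∧ p < i then 1 - e else e

/-- The effect of the generator `j` on the position of a vertex with position `p` and row `e`. -/
def stepPos (i j p e : ℕ) : ℕ :=
  -- The new row has no horizontal edge of label ≥ i - 1; hence `rho (i - 1)` is a transposition.
  if e = 1 ∧ i ≤ j + 1 then p else if p = j then j + 1 else if p = j + 1 then j else p

theorem pos_row_mk_step (_h : i ≤ r) (j : Fin r) (x : Vertex i r) :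
    pos (mk (stepPos i j (pos x) (row x)) (stepRow i j (pos x) (row x)) : Vertex i r) =
        stepPos i j (pos x) (row x) ∧
      row (mk (stepPos i j (pos x) (row x)) (stepRow i j (pos x) (row x)) : Vertex i r) =
        stepRow i j (pos x) (row x) := by
  have := row_pos_bounds x
  have := j.2
  refine pos_row_mk ?_
  unfold stepPos stepRow
  split_ifs <;> omega

/-- The generators of the group represented by the ladder. -/
def rho (h : i ≤ r) (j : Fin r) : Perm (Vertex i r) :=
  Function.Involutive.toPerm
    (fun x => mk (stepPos i j (pos x) (row x)) (stepRow i j (pos x) (row x))) fun x => by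
      obtain ⟨h₁, h₂⟩ := pos_row_mk_step h j x
      obtain ⟨h₃, h₄⟩ := pos_row_mk_step h j
        (mk (stepPos i j (pos x) (row x)) (stepRow i j (pos x) (row x)))
      have := row_pos_bounds x
      apply vertex_ext
      · rw [h₃, h₁, h₂]
        unfold stepPos stepRow
        split_ifs <;> omega
      · rw [h₄, h₁, h₂]
        unfold stepPos stepRow
        split_ifs <;> omega

theorem pos_rho (h : i ≤ r) (j : Fin r) (x : Vertex i r) :
    pos (rho h j x) = stepPos i j (pos x) (row x) := (pos_row_mk_step h j x).1

theorem row_rho (h : i ≤ r) (j : Fin r) (x : Vertex i r) :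
    row (rho h j x) = stepRow i j (pos x) (row x) := (pos_row_mk_step h j x).2

theorem rho_rho (h : i ≤ r) (j : Fin r) (x : Vertex i r) : rho h j (rho h j x) = x :=
  Function.Involutive.toPerm_involutive _ x

theorem orderOf_rho (h : i ≤ r) (j : Fin r) : orderOf (rho h j) = 2 := by
  refine orderOf_eq_prime (by ext1 x; simp [sq, rho_rho]) fun h1 => ?_
  have h2 := pos_rho h j (.inl j.castSucc)
  simp [h1, stepPos] at h2

theorem rho_mul_sq (h : i ≤ r) (j k : Fin r) (hjk : (j : ℕ) + 2 ≤ k ∨ (k : ℕ) + 2 ≤ j) :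
    (rho h j * rho h k) ^ 2 = 1 := by
  have hc : ∀ x, rho h j (rho h k x) = rho h k (rho h j x) := by
    intro x
    have := row_pos_bounds x
    apply vertex_ext
    · simp only [pos_rho, row_rho]
      grind (splits := 25) [stepPos, stepRow]
    · simp only [pos_rho, row_rho]
      grind (splits := 25) [stepPos, stepRow]
  ext1 x
  simp [sq, hc, rho_rho]

theorem simplexLadder_adj_iff (h : i ≤ r) (k : Fin r) (x y : Vertex i r) :
    (simplexLadder i r (by omega) k).Adj x y ↔ x ≠ y ∧ rho h k x = y := by
  have key : (x ≠ y ∧ rho h k x = y) ↔ ¬ (pos x = pos y ∧ row x = row y) ∧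
      (stepPos i k (pos x) (row x) = pos y ∧ stepRow i k (pos x) (row x) = row y) := by
    refine and_congr (not_congr ⟨fun e => e ▸ ⟨rfl, rfl⟩, fun e => vertex_ext e.1 e.2⟩) ?_
    rw [← pos_rho h, ← row_rho h]
    exact ⟨fun e => e ▸ ⟨rfl, rfl⟩, fun e => vertex_ext e.1 e.2⟩
  rw [key]
  rcases x with ⟨a, ha⟩ | ⟨a, ha⟩ <;> rcases y with ⟨b, hb⟩ | ⟨b, hb⟩ <;>
    simp only [simplexLadder, glueLadder, simplex, SimpleGraph.edge_adj, pos_inl, pos_inr,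
      row_inl, row_inr, ne_eq, Fin.ext_iff, Fin.val_castLE, Fin.val_castSucc, Fin.val_succ] <;>
    unfold stepPos stepRow
  all_goals grind (splits := 25)

/-! ### Invariants attached to an omitted label -/

/-- The blocks of imprimitivity of the subgroup generated by the generators `0, …, i`; all the
points that it fixes are put into a third class. -/
def block (x : Vertex i r) : ℕ :=
  if i + 1 < pos x then 2 else if row x = 1 ∨ pos x = i + 1 then 1 else 0

/-- The permutations satisfying the constraints imposed by omitting the generator `k`. -/
def maxParabolic (i r k : ℕ) : Subgroup (Perm (Vertex i r)) :=
  relAut (fun x _ => k < pos x) ⊓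
  relAut (fun x y => k < i ∧ pos x ≤ k ∧ pos y ≤ k ∧ row x = row y) ⊓
  relAut (fun x y => k < i ∧ pos x ≤ k ∧ pos x = pos y) ⊓
  relAut (fun x _ => k = i ∧ row x = 0) ⊓
  relAut (fun x y => k = i + 1 ∧ block x = block y)

theorem rho_mem_maxParabolic (h : i ≤ r) (j : Fin r) (k : ℕ) (hjk : (j : ℕ) ≠ k) :
    rho h j ∈ maxParabolic i r k := by
  refine ⟨⟨⟨⟨?_, ?_⟩, ?_⟩, ?_⟩, ?_⟩ <;> intro x y <;> have := row_pos_bounds x <;>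
    have := row_pos_bounds y <;> simp only [pos_rho, row_rho, block]
  · grind (splits := 25) [stepPos, stepRow]
  · grind (splits := 25) [stepPos, stepRow]
  · grind (splits := 25) [stepPos, stepRow]
  · grind (splits := 25) [stepPos, stepRow]
  · by_cases hk : k = i + 1
    · simp only [hk, true_and]
      grind (splits := 25) [stepPos, stepRow]
    · simp [hk]

/-! ### Explicit forms of the generators -/

theorem rho_mk (h : i ≤ r) (j : Fin r) {p e : ℕ} (hp : (e = 0 ∧ p ≤ r) ∨ (e = 1 ∧ p < i)) :
    rho h j (mk p e) = mk (stepPos i j p e) (stepRow i j p e) := by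
  change mk (stepPos i j (pos (mk p e : Vertex i r)) (row (mk p e : Vertex i r)))
    (stepRow i j (pos (mk p e : Vertex i r)) (row (mk p e : Vertex i r))) = _
  rw [(pos_row_mk hp).1, (pos_row_mk hp).2]

theorem eq_mk_iff {p e : ℕ} (hp : (e = 0 ∧ p ≤ r) ∨ (e = 1 ∧ p < i)) (x : Vertex i r) :
    x = mk p e ↔ pos x = p ∧ row x = e := by
  obtain ⟨h₁, h₂⟩ := pos_row_mk (r := r) hp
  exact ⟨fun hx => by rw [hx, h₁, h₂]; exact ⟨rfl, rfl⟩,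
    fun hx => vertex_ext (hx.1.trans h₁.symm) (hx.2.trans h₂.symm)⟩

/-- The generators `i - 1` and `i + 1, …, r - 1` are transpositions. -/
theorem rho_eq_swap (h : i ≤ r) (j : Fin r) (hj : (j : ℕ) + 1 = i ∨ i < j) :
    rho h j = swap (mk j 0) (mk (j + 1) 0) := by
  have hjr := j.2
  ext1 x
  have hx := row_pos_bounds x
  rw [swap_apply_def]
  simp only [eq_mk_iff (Or.inl ⟨rfl, hjr.le⟩ : _ ∨ ((0 : ℕ) = 1 ∧ (j : ℕ) < i)),
    eq_mk_iff (Or.inl ⟨rfl, hjr⟩ : ((0 : ℕ) = 0 ∧ (j : ℕ) + 1 ≤ r) ∨ ((0 : ℕ) = 1 ∧ (j : ℕ) + 1 < i))]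
  split_ifs with h₁ h₂
  · rw [eq_mk_iff (by omega), pos_rho, row_rho]
    grind [stepPos, stepRow]
  · rw [eq_mk_iff (by omega), pos_rho, row_rho]
    grind [stepPos, stepRow]
  · apply vertex_ext
    · rw [pos_rho]
      grind [stepPos]
    · rw [row_rho]
      grind [stepRow]

/-- The action of the permutations of `0, …, i - 1` on both rows simultaneously. -/
noncomputable def diag (h : i ≤ r) : Perm (Fin i) →* Perm (Vertex i r) :=
  (Perm.sumCongrHom _ _).comp
    ((Perm.viaEmbeddingHom (Fin.castLEEmb (Nat.le_succ_of_le h))).prod (MonoidHom.id _))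

theorem diag_inl (h : i ≤ r) (σ : Perm (Fin i)) (a : Fin (r + 1)) :
    diag h σ (.inl a) = .inl ((σ.viaEmbedding (Fin.castLEEmb (Nat.le_succ_of_le h))) a) := rfl

theorem row_diag (h : i ≤ r) (σ : Perm (Fin i)) (x : Vertex i r) : row (diag h σ x) = row x := by
  rcases x with a | p <;> rfl

theorem pos_diag_of_lt (h : i ≤ r) (σ : Perm (Fin i)) (x : Vertex i r) (hx : pos x < i) :
    pos (diag h σ x) = σ ⟨pos x, hx⟩ := by
  rcases x with a | p
  · rw [diag_inl]
    have := σ.viaEmbedding_apply (Fin.castLEEmb (Nat.le_succ_of_le h)) ⟨a, hx⟩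
    have ha : (Fin.castLEEmb (Nat.le_succ_of_le h)) (⟨a, hx⟩ : Fin i) = a := rfl
    rw [ha] at this
    rw [this]
    rfl
  · rfl

theorem diag_of_le (h : i ≤ r) (σ : Perm (Fin i)) (x : Vertex i r) (hx : i ≤ pos x) :
    diag h σ x = x := by
  rcases x with a | p
  · rw [diag_inl, Perm.viaEmbedding_apply_of_notMem]
    rintro ⟨q, rfl⟩
    have := q.2
    simp at hx
    omega
  · exact absurd p.2 (not_lt.2 hx)

theorem diag_swap (h : i ≤ r) (j : Fin r) (hj : (j : ℕ) + 1 < i) :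
    diag h (swap ⟨j, by omega⟩ ⟨j + 1, hj⟩) = rho h j := by
  ext1 x
  apply vertex_ext
  · rw [pos_rho]
    rcases lt_or_ge (pos x) i with hx | hx
    · rw [pos_diag_of_lt h _ x hx, swap_apply_def]
      simp only [Fin.ext_iff]
      grind [stepPos]
    · rw [diag_of_le h _ x hx]
      grind [stepPos]
  · rw [row_diag, row_rho]
    grind [stepRow]

/-! ### Transpositions and diagonal elements in parabolic subgroups -/

section Generation

variable {I : Set ℕ} {K : Subgroup (Perm (Vertex i r))} {h : i ≤ r}

/-- Descend from the transposition `rho (i - 1)`: conjugation by `rho k` turns (v_{k+1} v_{k+2})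
into (v_k v_{k+2}), and the two together give (v_k v_{k+1}). -/
theorem swap_simplex_mem (hK : ∀ j : Fin r, (j : ℕ) ∈ I → rho h j ∈ K) {k : ℕ}
    (hI : ∀ m, k ≤ m → m < i → m ∈ I) (hk : k < i) :
    swap (mk k 0 : Vertex i r) (mk (k + 1) 0) ∈ K := by
  obtain ⟨n, hn⟩ : ∃ n, n + k + 1 = i := ⟨i - 1 - k, by omega⟩
  have hρ := hK ⟨k, by omega⟩ (hI k le_rfl hk)
  induction n generalizing k with
  | zero =>
    rwa [rho_eq_swap h _ (Or.inl (by simp; omega))] at hρ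
  | succ n ih =>
    have h1 := ih (k := k + 1) (fun m hm => hI m (by omega)) (by omega) (by omega)
      (hK _ (hI (k + 1) (by omega) (by omega)))
    have h2 := swap_apply_mem hρ h1
    rw [rho_mk h _ (by omega), rho_mk h _ (by omega)] at h2
    have e1 : stepPos i k (k + 1) 0 = k := by grind [stepPos]
    have e2 : stepPos i k (k + 1 + 1) 0 = k + 1 + 1 := by grind [stepPos]
    have e3 : stepRow i k (k + 1) 0 = 0 := by grind [stepRow]
    have e4 : stepRow i k (k + 1 + 1) 0 = 0 := by grind [stepRow]
    simp only [e1, e2, e3, e4] at h2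
    rw [swap_comm] at h1
    exact SubmonoidClass.swap_mem_trans K h2 h1

theorem rho_eq_swap_mul_swap (h : i ≤ r) (j : Fin r) (hj : (j : ℕ) + 1 < i) :
    rho h j = swap (mk j 0) (mk (j + 1) 0) * swap (mk j 1) (mk (j + 1) 1) := by
  have hjr := j.2
  have e0 := pos_row_mk (i := i) (r := r) (p := j) (e := 0) (by omega)
  have e1 := pos_row_mk (i := i) (r := r) (p := j + 1) (e := 0) (by omega)
  have e2 := pos_row_mk (i := i) (r := r) (p := j) (e := 1) (by omega)
  have e3 := pos_row_mk (i := i) (r := r) (p := j + 1) (e := 1) (by omega)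
  ext1 x
  have hx := row_pos_bounds x
  have key : ∀ y : Vertex i r, ∀ p e, ((e = 0 ∧ p ≤ r) ∨ (e = 1 ∧ p < i)) →
    (y = mk p e ↔ pos y = p ∧ row y = e) := fun y p e hp => eq_mk_iff hp y
  rw [Perm.mul_apply, swap_apply_def, swap_apply_def]
  apply vertex_ext
  · rw [pos_rho]
    grind (splits := 20) [stepPos]
  · rw [row_rho]
    grind (splits := 20) [stepRow]

/-- `rho k` is a product of one transposition in each row, and the row-0 factor is already in `K`.
-/
theorem swap_rung_mem (hK : ∀ j : Fin r, (j : ℕ) ∈ I → rho h j ∈ K) {k : ℕ}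
    (hI : ∀ m, k ≤ m → m < i → m ∈ I) (hk : k + 1 < i) :
    swap (mk k 1 : Vertex i r) (mk (k + 1) 1) ∈ K := by
  have hρ := hK ⟨k, by omega⟩ (hI k le_rfl (by omega))
  rw [rho_eq_swap_mul_swap h _ hk] at hρ
  exact (K.mul_mem_cancel_left (swap_simplex_mem hK hI (by omega))).1 hρ

/-- Conjugating (v_{i-1} v_i) by `rho i` links the two rows. -/
theorem swap_corner_mem (hK : ∀ j : Fin r, (j : ℕ) ∈ I → rho h j ∈ K) (hir : i < r) (hi : 0 < i)
    (h0 : i - 1 ∈ I) (h1 : i ∈ I) :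
    swap (mk (i - 1) 1 : Vertex i r) (mk (i + 1) 0) ∈ K := by
  have h2 := swap_apply_mem (hK ⟨i, hir⟩ h1)
    (swap_simplex_mem hK (k := i - 1) (fun m hm hm' => by rwa [show m = i - 1 by omega]) (by omega))
  rw [rho_mk h _ (by omega), rho_mk h _ (by omega)] at h2
  have e1 : stepPos i i (i - 1) 0 = i - 1 := by grind [stepPos]
  have e2 : stepPos i i (i - 1 + 1) 0 = i + 1 := by grind [stepPos]
  have e3 : stepRow i i (i - 1) 0 = 1 := by grind [stepRow]
  have e4 : stepRow i i (i - 1 + 1) 0 = 0 := by grind [stepRow]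
  simpa only [e1, e2, e3, e4] using h2

theorem swap_tail_mem (hK : ∀ j : Fin r, (j : ℕ) ∈ I → rho h j ∈ K) {k : ℕ} (hk : i < k)
    (hkr : k < r) (h0 : k ∈ I) : swap (mk k 0 : Vertex i r) (mk (k + 1) 0) ∈ K := by
  have h1 := hK ⟨k, hkr⟩ h0
  rwa [rho_eq_swap h _ (Or.inr hk)] at h1

/-- Conjugating (v_{i+1} v_{i+2}) by `rho i` gives (v_i v_{i+2}). -/
theorem swap_bridge_mem (hK : ∀ j : Fin r, (j : ℕ) ∈ I → rho h j ∈ K) (hir : i + 1 < r)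
    (h0 : i ∈ I) (h1 : i + 1 ∈ I) : swap (mk i 0 : Vertex i r) (mk (i + 1) 0) ∈ K := by
  have h3 := swap_tail_mem hK (Nat.lt_succ_self i) hir h1
  have h2 := swap_apply_mem (hK ⟨i, by omega⟩ h0) h3
  rw [rho_mk h _ (by omega), rho_mk h _ (by omega)] at h2
  have e1 : stepPos i i (i + 1) 0 = i := by grind [stepPos]
  have e2 : stepPos i i (i + 1 + 1) 0 = i + 1 + 1 := by grind [stepPos]
  have e3 : stepRow i i (i + 1) 0 = 0 := by grind [stepRow]
  have e4 : stepRow i i (i + 1 + 1) 0 = 0 := by grind [stepRow]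
  simp only [Nat.succ_eq_add_one, e1, e2, e3, e4] at h2 h3
  rw [swap_comm] at h3
  exact SubmonoidClass.swap_mem_trans K h2 h3

/-- Transpositions in the group generated by the generators with labels in `I`, all of `a, …, i - 1`
being in `I`. -/
theorem swap_mem_of_invariants (hK : ∀ j : Fin r, (j : ℕ) ∈ I → rho h j ∈ K) {a : ℕ}
    (hir : i < r) (hI : ∀ m, a ≤ m → m < i → m ∈ I) (hIr : ∀ m ∈ I, m < r)
    {x y : Vertex i r} (hx : a ≤ pos x) (hy : a ≤ pos y)
    (hU : ∀ k, i < k → k ∉ I → (k < pos x ↔ k < pos y))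
    (hR : i ∉ I → (row x = row y ∧ (i < pos x ↔ i < pos y)))
    (hB : i ∈ I → i + 1 ∉ I → block x = block y) : swap x y ∈ K := by
  have hsimplex : ∀ p q, a ≤ p → p ≤ q → q ≤ r →
      (∀ k, i < k → k ∉ I → (k < p ↔ k < q)) → (i ∉ I → (i < p ↔ i < q)) →
      (i ∈ I → i + 1 ∉ I → (i < p ↔ i < q)) → swap (mk p 0 : Vertex i r) (mk q 0) ∈ K := by
    intro p q hp hpq hqr h1 h2 h3
    refine swap_mem_of_consecutive (fun k => mk k 0) hpq fun k hk hkq => ?_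
    rcases lt_trichotomy k i with hki | rfl | hki
    · exact swap_simplex_mem hK (fun m hm => hI m (by omega)) hki
    · by_cases hkI : k ∈ I
      · by_cases hkI' : k + 1 ∈ I
        · exact swap_bridge_mem hK (hIr _ hkI') hkI hkI'
        · have := h3 hkI hkI'
          omega
      · have := h2 hkI
        omega
    · by_cases hkI : k ∈ I
      · exact swap_tail_mem hK hki (by omega) hkI
      · have := h1 k hki hkI
        omega
  have hrungs : ∀ p q, a ≤ p → p ≤ q → q < i → swap (mk p 1 : Vertex i r) (mk q 1) ∈ K := by
    intro p q hp hpq hqi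
    exact swap_mem_of_consecutive (fun k => mk k 1) hpq fun k hk hkq =>
      swap_rung_mem hK (fun m hm => hI m (by omega)) (by omega)
  have hmixed : ∀ p q, a ≤ p → p ≤ r → a ≤ q → q < i → i ∈ I → (i + 1 ∉ I → p = i + 1) →
      (∀ k, i < k → k ∉ I → ¬ k < p) → swap (mk p 0 : Vertex i r) (mk q 1) ∈ K := by
    intro p q hp hpr hq hqi h1 h2 h3
    -- The route is v_p, v_{i+1}, w_{i-1}, w_q, changing rows at the corner.
    have hc := swap_corner_mem hK hir (by omega) (hI (i - 1) (by omega) (by omega)) h1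
    rw [swap_comm] at hc
    have hw := hrungs q (i - 1) hq (by omega) (by omega)
    rw [swap_comm] at hw
    have hv : swap (mk p 0 : Vertex i r) (mk (i + 1) 0) ∈ K := by
      by_cases h4 : i + 1 ∈ I
      · rcases le_total p (i + 1) with h5 | h5
        · refine hsimplex p (i + 1) hp h5 (by omega) (fun k hk hkI => ?_) (by tauto) (by tauto)
          have := h3 k hk hkI
          omega
        · rw [swap_comm]
          refine hsimplex (i + 1) p (by omega) h5 (by omega) (fun k hk hkI => ?_) (by tauto)
            (by tauto)
          have := h3 k hk hkI
          omega
      · rw [h2 h4, swap_self]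
        exact K.one_mem
    exact SubmonoidClass.swap_mem_trans K (SubmonoidClass.swap_mem_trans K hv hc) hw
  have hbx := row_pos_bounds x
  have hby := row_pos_bounds y
  rw [← mk_pos_row x, ← mk_pos_row y]
  have hB' : i ∈ I → i + 1 ∉ I → ¬ i + 1 < pos x → ¬ i + 1 < pos y →
      ((row x = 1 ∨ pos x = i + 1) ↔ (row y = 1 ∨ pos y = i + 1)) := by
    intro h1 h2 h3 h4
    have := hB h1 h2
    unfold block at this
    rw [if_neg h3, if_neg h4] at this
    grind
  rcases hbx with ⟨hx0, hxr⟩ | ⟨hx1, hxi⟩ <;> rcases hby with ⟨hy0, hyr⟩ | ⟨hy1, hyi⟩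
  · rw [hx0, hy0]
    have hBp : i ∈ I → i + 1 ∉ I → (i < pos x ↔ i < pos y) := by
      intro h1 h2
      have := hB' h1 h2
      have := hU (i + 1) (by omega) h2
      omega
    rcases le_total (pos x) (pos y) with hxy | hxy
    · exact hsimplex _ _ hx hxy hyr hU (fun hi => (hR hi).2) hBp
    · rw [swap_comm]
      exact hsimplex _ _ hy hxy hxr (fun k hk hkI => (hU k hk hkI).symm)
        (fun hi => (hR hi).2.symm) fun h1 h2 => (hBp h1 h2).symm
  · rw [hx0, hy1]
    have hi : i ∈ I := by
      by_contra hi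
      have := (hR hi).1
      omega
    refine hmixed _ _ hx hxr hy hyi hi (fun h1 => ?_) fun k hk hkI => ?_
    · have := hB' hi h1
      have := hU (i + 1) (by omega) h1
      omega
    · have := hU k hk hkI
      omega
  · rw [hx1, hy0, swap_comm]
    have hi : i ∈ I := by
      by_contra hi
      have := (hR hi).1
      omega
    refine hmixed _ _ hy hyr hx hxi hi (fun h1 => ?_) fun k hk hkI => ?_
    · have := hB' hi h1
      have := hU (i + 1) (by omega) h1
      omega
    · have := hU k hk hkI
      omega
  · rw [hx1, hy1]
    rcases le_total (pos x) (pos y) with hxy | hxy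
    · exact hrungs _ _ hx hxy hyi
    · rw [swap_comm]
      exact hrungs _ _ hy hxy hxi

theorem diag_mem (hK : ∀ j : Fin r, (j : ℕ) ∈ I → rho h j ∈ K) (σ : Perm (Fin i))
    (hσ : ∀ k, k + 1 < i → k ∉ I → ∀ p : Fin i, (k < (σ p : ℕ) ↔ k < (p : ℕ))) :
    diag h σ ∈ K := by
  -- Pulled back along `diag`, the labels below i - 1 are adjacent transpositions, so σ only has to
  -- respect the cuts at missing labels.
  have key : ∀ p q : Fin i, p ≤ q → (∀ k, (p : ℕ) ≤ k → k < q → k ∈ I) →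
      swap p q ∈ K.comap (diag h) := by
    intro p q hpq hk
    have := swap_mem_of_consecutive (K := K.comap (diag h))
      (fun k => if hk : k < i then (⟨k, hk⟩ : Fin i) else p) (p := p) (q := q) hpq fun k h1 h2 => by
        have hki : k + 1 < i := by omega
        rw [dif_pos (by omega), dif_pos hki, Subgroup.mem_comap,
          diag_swap h ⟨k, by omega⟩ hki]
        exact hK ⟨k, by omega⟩ (hk k h1 h2)
    simpa using this
  refine mem_of_forall_swap_mem (K.comap (diag h)) fun p => ?_
  have hI : ∀ k, k + 1 < i → ((p : ℕ) ≤ k ∧ k < σ p ∨ (σ p : ℕ) ≤ k ∧ k < p) → k ∈ I := by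
    intro k hk hkp
    by_contra hkI
    have := hσ k hk hkI p
    omega
  rcases le_total p (σ p) with hp | hp
  · exact key _ _ hp fun k h1 h2 => hI k (by omega) (by omega)
  · rw [swap_comm]
    exact key _ _ hp fun k h1 h2 => hI k (by omega) (by omega)

end Generation

section MaxParabolic

variable {k : ℕ} {g : Perm (Vertex i r)}

theorem lt_pos_iff (hg : g ∈ maxParabolic i r k) (x : Vertex i r) :
    k < pos (g x) ↔ k < pos x :=
  hg.1.1.1.1 x x

theorem row_eq_iff (hg : g ∈ maxParabolic i r k) (hk : k < i) {x y : Vertex i r} (hx : pos x ≤ k)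
    (hy : pos y ≤ k) : row (g x) = row (g y) ↔ row x = row y := by
  have h1 := hg.1.1.1.2 x y
  have h2 := lt_pos_iff hg x
  have h3 := lt_pos_iff hg y
  have h4 : pos (g x) ≤ k := by omega
  have h5 : pos (g y) ≤ k := by omega
  simpa only [hk, hx, hy, h4, h5, true_and] using h1

theorem pos_eq_iff (hg : g ∈ maxParabolic i r k) (hk : k < i) {x y : Vertex i r} (hx : pos x ≤ k) :
    pos (g x) = pos (g y) ↔ pos x = pos y := by
  have h1 := hg.1.1.2 x y
  have h2 := lt_pos_iff hg x
  have h4 : pos (g x) ≤ k := by omega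
  simpa only [hk, hx, h4, true_and] using h1

theorem row_eq_zero_iff (hg : g ∈ maxParabolic i r i) (x : Vertex i r) :
    row (g x) = 0 ↔ row x = 0 := by
  simpa only [true_and] using hg.1.2 x x

theorem block_eq_iff (hg : g ∈ maxParabolic i r (i + 1)) (x y : Vertex i r) :
    block (g x) = block (g y) ↔ block x = block y := by
  simpa only [true_and] using hg.2 x y

end MaxParabolic

/-! ### Parabolic subgroups are determined by their invariants -/

section Generation

variable {I : Set ℕ} {K : Subgroup (Perm (Vertex i r))} {h : i ≤ r}

/-- Rows and blocks may be constrained only as partitions, leaving their exchange free; `rho i`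
undoes it. If a > 0, v_0 lands at a position < a ≤ i, where row 0 and block 0 agree, so one
correction serves both. -/
theorem exists_mul_row_eq_zero (hK : ∀ j : Fin r, (j : ℕ) ∈ I → rho h j ∈ K) {a : ℕ} (hir : i < r)
    (hi : 0 < i) (ha : a ≤ i) (haI : 0 < a → a - 1 ∉ I)
    {g : Perm (Vertex i r)} (hg : ∀ k ∉ I, g ∈ maxParabolic i r k) :
    ∃ u ∈ K, (0 < a → row (u (g (mk 0 0))) = 0) ∧
      (i ∈ I → i + 1 ∉ I → block (u (g (mk 0 0))) = 0) := by
  set y := g (mk 0 0) with hy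
  obtain ⟨hp, hr⟩ := pos_row_mk (i := i) (r := r) (p := 0) (e := 0) (by omega)
  have hby := row_pos_bounds y
  have hya : 0 < a → pos y < a := by
    intro h0
    have := lt_pos_iff (hg _ (haI h0)) (mk 0 0)
    rw [hp, ← hy] at this
    omega
  by_cases hiI : i ∈ I
  · by_cases hgood : (0 < a → row y = 0) ∧ (i + 1 ∉ I → block y = 0)
    · exact ⟨1, K.one_mem, hgood.1, fun _ => hgood.2⟩
    · refine ⟨rho h ⟨i, hir⟩, hK _ hiI, fun h0 => ?_, fun _ h1 => ?_⟩
      · have := hya h0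
        rw [row_rho]
        grind [stepRow, block]
      · have := lt_pos_iff (hg _ h1) (mk 0 0)
        rw [hp] at this
        unfold block at hgood ⊢
        rw [row_rho, pos_rho]
        grind [stepRow, stepPos]
  · exact ⟨1, K.one_mem, fun _ => (row_eq_zero_iff (hg i hiI) (mk 0 0)).2 hr, fun h1 => absurd h1 hiI⟩

theorem exists_mul_fixes (hK : ∀ j : Fin r, (j : ℕ) ∈ I → rho h j ∈ K) {a : ℕ}
    (h0 : 0 < a) (ha : a ≤ i) (haI : a - 1 ∉ I)
    {g : Perm (Vertex i r)} (hg : ∀ k ∉ I, g ∈ maxParabolic i r k) (hrow : row (g (mk 0 0)) = 0) :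
    ∃ u ∈ K, ∀ x, pos x < a → u (g x) = x := by
  have hg1 := hg _ haI
  have hlt : a - 1 < i := by omega
  have hv : ∀ p, p < i → pos (mk p 0 : Vertex i r) = p ∧ row (mk p 0 : Vertex i r) = 0 :=
    fun p hp => pos_row_mk (by omega)
  have hpos : ∀ x : Vertex i r, pos x < a → pos (g x) < a := by
    intro x hx
    have := lt_pos_iff hg1 x
    omega
  have hpos' : ∀ p : Fin i, (p : ℕ) < a → pos (g (mk p 0)) < a := fun p hp =>
    hpos _ (by rwa [(hv p p.2).1])
  -- The permutation of columns induced by `g` left of a, extended by the identity.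
  let f : Fin i → Fin i := fun p =>
    if hp : (p : ℕ) < a then ⟨pos (g (mk p 0)), (hpos' p hp).trans_le ha⟩ else p
  have hf1 : ∀ p : Fin i, (p : ℕ) < a → (f p : ℕ) = pos (g (mk p 0)) := by
    intro p hp
    simp only [f, dif_pos hp]
  have hf2 : ∀ p : Fin i, ¬ (p : ℕ) < a → f p = p := by
    intro p hp
    simp only [f, dif_neg hp]
  have hinj : Function.Injective f := by
    intro p q hpq
    by_cases hp : (p : ℕ) < a <;> by_cases hq : (q : ℕ) < a
    · have h1 := congrArg Fin.val hpq
      rw [hf1 p hp, hf1 q hq, pos_eq_iff hg1 hlt (by rw [(hv p p.2).1]; omega), (hv p p.2).1,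
        (hv q q.2).1] at h1
      exact Fin.ext h1
    · have h1 := congrArg Fin.val hpq
      rw [hf1 p hp, hf2 q hq] at h1
      have := hpos' p hp
      omega
    · have h1 := congrArg Fin.val hpq
      rw [hf2 p hp, hf1 q hq] at h1
      have := hpos' q hq
      omega
    · rwa [hf2 p hp, hf2 q hq] at hpq
  let σ : Perm (Fin i) := Equiv.ofBijective f hinj.bijective_of_finite
  have hσ : ∀ p, σ p = f p := fun p => rfl
  have hmem : diag h σ ∈ K := by
    refine diag_mem hK σ fun k hk hkI p => ?_
    rw [hσ]
    by_cases hp : (p : ℕ) < a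
    · rw [hf1 p hp, lt_pos_iff (hg k hkI), (hv p p.2).1]
    · rw [hf2 p hp]
  refine ⟨(diag h σ)⁻¹, K.inv_mem hmem, fun x hx => ?_⟩
  rw [Perm.inv_eq_iff_eq]
  apply vertex_ext
  · rw [pos_diag_of_lt h σ x (by omega), hσ, hf1 _ hx, pos_eq_iff hg1 hlt (by omega)]
    exact (hv _ (by omega)).1.symm
  · rw [row_diag]
    -- As v_0 stays in row 0, preserving the partition into rows left of a means preserving each
    -- row.
    have h1 := row_eq_iff hg1 hlt (x := x) (y := mk 0 0) (by omega)
      (by rw [(hv 0 (by omega)).1]; omega)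
    rw [hrow, (hv 0 (by omega)).2] at h1
    have := row_pos_bounds x
    have := row_pos_bounds (g x)
    omega

/-- A permutation satisfying the constraints of all the generators with labels outside `I` is
generated by the generators with labels in `I`. -/
theorem mem_of_forall_mem_maxParabolic (hK : ∀ j : Fin r, (j : ℕ) ∈ I → rho h j ∈ K)
    (hKI : ∀ k ∉ I, K ≤ maxParabolic i r k) (hir : i < r) (hi : 0 < i) (hIr : ∀ m ∈ I, m < r)
    {g : Perm (Vertex i r)} (hg : ∀ k ∉ I, g ∈ maxParabolic i r k) : g ∈ K := by
  obtain ⟨a, ha, haI, hI⟩ : ∃ a ≤ i, (0 < a → a - 1 ∉ I) ∧ ∀ m, a ≤ m → m < i → m ∈ I := by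
    classical
    have hex : ∃ a, a ≤ i ∧ ∀ m, a ≤ m → m < i → m ∈ I := ⟨i, le_rfl, fun m h1 h2 => by omega⟩
    refine ⟨Nat.find hex, (Nat.find_spec hex).1, fun h0 hmem => ?_, (Nat.find_spec hex).2⟩
    refine Nat.find_min hex (m := Nat.find hex - 1) (by omega)
      ⟨(Nat.sub_le _ _).trans (Nat.find_spec hex).1, fun m h1 h2 => ?_⟩
    rcases h1.eq_or_lt with rfl | h1
    · exact hmem
    · exact (Nat.find_spec hex).2 m (by omega) h2
  obtain ⟨hp0, hr0⟩ := pos_row_mk (i := i) (r := r) (p := 0) (e := 0) (by omega)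
  have hb0 : block (mk 0 0 : Vertex i r) = 0 := by
    unfold block
    rw [hp0, hr0]
    simp
  obtain ⟨u, hu, hu1, hu2⟩ := exists_mul_row_eq_zero hK hir hi ha haI hg
  have hug : ∀ k ∉ I, u * g ∈ maxParabolic i r k := fun k hk =>
    Subgroup.mul_mem _ (hKI k hk hu) (hg k hk)
  obtain ⟨w, hw, hw1, hw2⟩ : ∃ w ∈ K, (∀ x, pos x < a → w ((u * g) x) = x) ∧
      (i ∈ I → i + 1 ∉ I → block (w ((u * g) (mk 0 0))) = 0) := by
    rcases Nat.eq_zero_or_pos a with rfl | h0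
    · exact ⟨1, K.one_mem, fun x hx => absurd hx (Nat.not_lt_zero _), hu2⟩
    · obtain ⟨w, hw, hw1⟩ := exists_mul_fixes hK h0 ha (haI h0) hug (hu1 h0)
      exact ⟨w, hw, hw1, fun _ _ => by rw [hw1 _ (by omega), hb0]⟩
  have hwug : ∀ k ∉ I, w * (u * g) ∈ maxParabolic i r k := fun k hk =>
    Subgroup.mul_mem _ (hKI k hk hw) (hug k hk)
  suffices hmem : w * (u * g) ∈ K from
    (K.mul_mem_cancel_left hu).1 ((K.mul_mem_cancel_left hw).1 hmem)
  set f := w * (u * g) with hf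
  refine mem_of_forall_swap_mem K fun x => ?_
  rcases lt_or_ge (pos x) a with hx | hx
  · have : f x = x := hw1 x hx
    rw [this, swap_self]
    exact K.one_mem
  · have hfx : a ≤ pos (f x) := by
      rcases Nat.eq_zero_or_pos a with rfl | h0
      · exact Nat.zero_le _
      · have := lt_pos_iff (hwug _ (haI h0)) x
        omega
    refine swap_mem_of_invariants hK hir hI hIr hx hfx
      (fun k _ hkI => (lt_pos_iff (hwug k hkI) x).symm) (fun hiI => ⟨?_, ?_⟩) fun hiI hiI' => ?_
    · have := row_eq_zero_iff (hwug i hiI) x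
      have := row_pos_bounds x
      have := row_pos_bounds (f x)
      omega
    · exact (lt_pos_iff (hwug i hiI) x).symm
    · have h1 := block_eq_iff (hwug _ hiI') x (mk 0 0)
      have h2 : block (f (mk 0 0)) = 0 := hw2 hiI hiI'
      have h3 := lt_pos_iff (hwug _ hiI') x
      rw [h2, hb0] at h1
      unfold block at h1 ⊢
      grind

/-- Every natural number k ≥ r counts as an omitted label; this builds in the block system when r =
i + 1. -/
theorem mem_closure_rho_iff (hi : 0 < i) (hir : i < r) (I : Set (Fin r))
    (g : Perm (Vertex i r)) :
    g ∈ Subgroup.closure (rho hir.le '' I) ↔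
      ∀ k : ℕ, k ∉ Fin.val '' I → g ∈ maxParabolic i r k := by
  have hKI : ∀ k ∉ Fin.val '' I, Subgroup.closure (rho hir.le '' I) ≤ maxParabolic i r k := by
    intro k hk
    rw [Subgroup.closure_le]
    rintro _ ⟨j, hj, rfl⟩
    exact rho_mem_maxParabolic hir.le j k fun hjk => hk ⟨j, hj, hjk⟩
  refine ⟨fun hg k hk => hKI k hk hg, fun hg => ?_⟩
  refine mem_of_forall_mem_maxParabolic (h := hir.le) (I := Fin.val '' I) ?_ hKI hir hi ?_ hg
  · rintro j ⟨j', hj', hjj'⟩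
    exact Subgroup.subset_closure ⟨j, Fin.ext hjj' ▸ hj', rfl⟩
  · rintro _ ⟨j, -, rfl⟩
    exact j.2

end Generation

/-! ### The string C-group and its isomorphism type -/

theorem isStringCGroup_rho (hi : 0 < i) (hir : i < r) :
    IsStringCGroup (Subgroup.closure (Set.range (rho hir.le))) (rho hir.le) where
  involution := orderOf_rho _
  generates := rfl
  string := rho_mul_sq _
  intersection I J := by
    ext g
    rw [Subgroup.mem_inf, mem_closure_rho_iff hi hir, mem_closure_rho_iff hi hir,
      mem_closure_rho_iff hi hir,
      Set.image_inter Fin.val_injective]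
    constructor
    · rintro ⟨h1, h2⟩ k hk
      by_cases hkI : k ∈ Fin.val '' I
      · exact h2 k fun hkJ => hk ⟨hkI, hkJ⟩
      · exact h1 k hkI
    · exact fun h => ⟨fun k hk => h k fun hk' => hk hk'.1, fun k hk => h k fun hk' => hk hk'.2⟩

theorem isPermRepGraph_rho (h : i ≤ r) :
    IsPermRepGraph (simplexLadder i r (by omega)) (Subgroup.closure (Set.range (rho h)))
      (rho h) where
  involution := orderOf_rho _
  generates := rfl
  adj_iff := simplexLadder_adj_iff h

theorem mem_closure_range_rho_iff (hi : 0 < i) (hir : i < r) (g : Perm (Vertex i r)) :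
    g ∈ Subgroup.closure (Set.range (rho hir.le)) ↔ ∀ k ≥ r, g ∈ maxParabolic i r k := by
  rw [← Set.image_univ, mem_closure_rho_iff hi hir]
  refine forall_congr' fun k => ?_
  rw [show k ∉ Fin.val '' (Set.univ : Set (Fin r)) ↔ k ≥ r by simp]

theorem not_lt_pos {k : ℕ} (hir : i ≤ r) (hk : r ≤ k) (x : Vertex i r) : ¬ k < pos x := by
  have := row_pos_bounds x
  omega

theorem mem_maxParabolic_of_lt {k : ℕ} (hir : i < r) (hk : r ≤ k) (hik : i + 1 < k)
    (g : Perm (Vertex i r)) : g ∈ maxParabolic i r k := by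
  refine ⟨⟨⟨⟨fun x y => ?_, fun x y => ?_⟩, fun x y => ?_⟩, fun x y => ?_⟩, fun x y => ?_⟩
  · exact iff_of_false (not_lt_pos hir.le hk _) (not_lt_pos hir.le hk _)
  all_goals exact iff_of_false (by omega) (by omega)

theorem closure_range_rho_eq_top (hi : 0 < i) (hir : i + 1 < r) :
    Subgroup.closure (Set.range (rho (by omega : i ≤ r))) = ⊤ := by
  refine (Subgroup.eq_top_iff' _).2 fun g => (mem_closure_range_rho_iff hi (by omega) g).2 ?_
  exact fun k hk => mem_maxParabolic_of_lt (by omega) hk (by omega) g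

/-- The permutations of `Λ × Q` that come from the wreath product `Sym(Λ) ≀ Q` are those which act
on the second coordinate by a translation. -/
theorem mem_range_toPerm_iff {Λ Q : Type*} [Group Q] {f : Perm (Λ × Q)} :
    f ∈ (RegularWreathProduct.toPerm (Perm Λ) Q Λ).range ↔ ∃ c : Q, ∀ z, (f z).2 = c * z.2 := by
  constructor
  · rintro ⟨w, rfl⟩
    exact ⟨w.right, fun z => rfl⟩
  · rintro ⟨c, hc⟩
    have hc' : ∀ z, (f⁻¹ z).2 = c⁻¹ * z.2 := fun z => by
      rw [eq_inv_mul_iff_mul_eq, ← hc, Perm.coe_inv, apply_symm_apply]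
    refine ⟨⟨fun q => ⟨fun l => (f (l, c⁻¹ * q)).1, fun l => (f⁻¹ (l, q)).1, fun l => ?_,
      fun l => ?_⟩, c⟩, ?_⟩
    · have h1 : ((f (l, c⁻¹ * q)).1, q) = f (l, c⁻¹ * q) := by
        ext
        · rfl
        · simp [hc]
      simp [h1]
    · have h1 : ((f⁻¹ (l, q)).1, c⁻¹ * q) = f⁻¹ (l, q) := by
        ext
        · rfl
        · exact (hc' (l, q)).symm
      simp only [h1]
      simp
    · ext1 ⟨l, q⟩
      change ((f (l, c⁻¹ * (c * q))).1, c * q) = f (l, q)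
      ext
      · simp
      · exact (hc (l, q)).symm

/-- For a group of order two, translations are the same as permutations. -/
theorem mem_range_toPerm_zmod_two_iff {Λ : Type*} [Nonempty Λ]
    {f : Perm (Λ × Multiplicative (ZMod 2))} :
    f ∈ (RegularWreathProduct.toPerm (Perm Λ) (Multiplicative (ZMod 2)) Λ).range ↔
      ∀ z z', (f z).2 = (f z').2 ↔ z.2 = z'.2 := by
  rw [mem_range_toPerm_iff]
  constructor
  · rintro ⟨c, hc⟩ z z'
    rw [hc, hc, mul_right_inj]
  · intro hf
    obtain ⟨l⟩ := ‹Nonempty Λ›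
    have key : ∀ a c q : Multiplicative (ZMod 2), (a = c ↔ q = 1) → a = c * q := by decide
    exact ⟨(f (l, 1)).2, fun z => key _ _ _ (hf z (l, 1))⟩

theorem block_lt_two (x : Vertex i (i + 1)) : block x < 2 := by
  have := row_pos_bounds x
  unfold block
  grind

/-- The coordinates of a vertex with respect to the two blocks, for `r = i + 1`. -/
def blockCoord (x : Vertex i (i + 1)) : Fin (i + 1) × Multiplicative (ZMod 2) :=
  -- The cap moves only v_{i+1}, which fills the place i missing from w_0, …, w_{i-1} in block 1.
  (⟨min (pos x) i, by omega⟩, Multiplicative.ofAdd (block x : ZMod 2))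

theorem blockCoord_snd_eq_iff (x y : Vertex i (i + 1)) :
    (blockCoord x).2 = (blockCoord y).2 ↔ block x = block y := by
  change (block x : ZMod 2) = (block y : ZMod 2) ↔ _
  rw [ZMod.natCast_eq_natCast_iff', Nat.mod_eq_of_lt (block_lt_two x),
    Nat.mod_eq_of_lt (block_lt_two y)]

theorem blockCoord_bijective : Function.Bijective (blockCoord (i := i)) := by
  rw [Fintype.bijective_iff_injective_and_card]
  constructor
  · intro x y hxy
    have h1 : min (pos x) i = min (pos y) i := congrArg (fun z => (z.1 : ℕ)) hxy
    have h2 := (blockCoord_snd_eq_iff x y).1 (congrArg Prod.snd hxy)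
    have := row_pos_bounds x
    have := row_pos_bounds y
    unfold block at h2
    apply vertex_ext <;> grind
  · simp [ZMod.card]
    ring

theorem mem_closure_range_rho_succ_iff (hi : 0 < i) (g : Perm (Vertex i (i + 1))) :
    g ∈ Subgroup.closure (Set.range (rho (Nat.le_succ i))) ↔
      ∀ x y, block (g x) = block (g y) ↔ block x = block y := by
  rw [mem_closure_range_rho_iff hi (Nat.lt_succ_self i)]
  refine ⟨fun hg => block_eq_iff (hg (i + 1) le_rfl), fun hg k hk => ?_⟩
  rcases eq_or_lt_of_le hk with rfl | hk'
  · refine ⟨⟨⟨⟨fun x y => ?_, fun x y => ?_⟩, fun x y => ?_⟩, fun x y => ?_⟩, fun x y => ?_⟩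
    · exact iff_of_false (not_lt_pos (Nat.le_succ i) hk _) (not_lt_pos (Nat.le_succ i) hk _)
    · exact iff_of_false (by omega) (by omega)
    · exact iff_of_false (by omega) (by omega)
    · exact iff_of_false (by omega) (by omega)
    · exact and_congr_right fun _ => hg x y
  · exact mem_maxParabolic_of_lt (Nat.lt_succ_self i) hk hk' g

/-- For `r = i + 1` the ladder represents a wreath product with the group of order two. -/
theorem nonempty_closure_range_rho_mulEquiv (hi : 0 < i) :
    Nonempty (Subgroup.closure (Set.range (rho (Nat.le_succ i))) ≃*
      RegularWreathProduct (Perm (Fin (i + 1))) (Multiplicative (ZMod 2))) := by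
  let e : Vertex i (i + 1) ≃ Fin (i + 1) × Multiplicative (ZMod 2) :=
    Equiv.ofBijective blockCoord blockCoord_bijective
  let T := RegularWreathProduct.toPerm (Perm (Fin (i + 1))) (Multiplicative (ZMod 2)) (Fin (i + 1))
  let Φ := e.symm.permCongrHom.toMonoidHom.comp T
  have hΦ : Function.Injective Φ := e.symm.permCongrHom.injective.comp
    (RegularWreathProduct.toPermInj _ _ _)
  have hrange : Subgroup.closure (Set.range (rho (Nat.le_succ i))) = Φ.range := by
    ext g
    have h1 : g ∈ Φ.range ↔ e.permCongr g ∈ T.range := by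
      constructor
      · rintro ⟨w, rfl⟩
        refine ⟨w, ?_⟩
        ext1 z
        simp [Φ]
      · rintro ⟨w, hw⟩
        refine ⟨w, ?_⟩
        ext1 x
        simp [Φ, hw]
    -- Both groups are now the stabiliser of a partition into two blocks, matched by `e`.
    rw [h1, mem_range_toPerm_zmod_two_iff, mem_closure_range_rho_succ_iff hi]
    have h2 : ∀ x, (e x) = blockCoord x := fun x => rfl
    constructor
    · intro hg z z'
      have := hg (e.symm z) (e.symm z')
      rw [← blockCoord_snd_eq_iff, ← blockCoord_snd_eq_iff, ← h2, ← h2, ← h2, ← h2] at this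
      simpa using this
    · intro hg x y
      have := hg (e x) (e y)
      simp only [permCongr_apply, symm_apply_apply] at this
      simpa only [h2, blockCoord_snd_eq_iff] using this
  exact ⟨(MulEquiv.subgroupCongr hrange).trans (MonoidHom.ofInjective hΦ).symm⟩

end SimplexLadder

open SimplexLadder

theorem proposition4p11 (i r : ℕ) (hi : 2 ≤ i) (hr : i + 1 ≤ r) :
    IsCPRGraph (simplexLadder i r (by omega)) ∧
    (i + 1 < r →
      Represents (simplexLadder i r (by omega)) (Equiv.Perm (Fin (r + i + 1)))) ∧
    (r = i + 1 →
      Represents (simplexLadder i r (by omega))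
        (RegularWreathProduct (Equiv.Perm (Fin r)) (Multiplicative (ZMod 2)))) := by
  have hi0 : 0 < i := by omega
  have hir : i < r := hr
  refine ⟨⟨_, rho hir.le, isPermRepGraph_rho hir.le, isStringCGroup_rho hi0 hir⟩, fun h => ?_, ?_⟩
  · refine ⟨_, rho hir.le, isPermRepGraph_rho hir.le, ⟨?_⟩⟩
    exact (MulEquiv.subgroupCongr (closure_range_rho_eq_top hi0 h)).trans
      (Subgroup.topEquiv.trans (Fintype.equivFinOfCardEq (by simp; omega)).permCongrHom)
  · rintro rfl
    exact ⟨_, rho hir.le, isPermRepGraph_rho hir.le, nonempty_closure_range_rho_mulEquiv hi0⟩
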